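/- Let $\mathbb N=\{0,1,2,\dots\}$. Colours are symbols $a_kb_\ell$ with $k,\ell\in\mathbb N$; the colour is free if $k=\ell$ and bound if $k\ne\ell$. A coloured partition is a finite (possibly empty) non-increasing sequence $\lambda_1+\cdots+\lambda_s$ of positive integers (the parts), each with a colour $c(\lambda_j)$; $p_c$ denotes a part of size $p$ and colour $c$. Put $$\Delta(a_ib_k,a_{i'}b_{k'})=\chi(i\ge i')-\chi(i=k=i')+\chi(k\le k')-\chi(k=i'=k'),$$ where $\chi(P)$ is $1$ if $P$ is true and $0$ otherwise. For $n\ge 1$ let $\mathcal P_n$ be the set of coloured partitions with all colours in $\{a_ib_k:0\le i,k\le n-1\}$ and $\lambda_j-\lambda_{j+1}\ge\Delta(c(\lambda_j),c(\lambda_{j+1}))$ for $1\le j\le s-1$. Let $\mathcal P^0$ be the set of coloured partitions all of whose parts are coloured $a_0b_0$ (with no other condition). An integer-valued function $\delta$ of bound colours satisfies Condition 1 if $\min\{k,\ell\}<\delta(a_kb_\ell)\le\max\{k,\ell\}$ for all $k\ne\ell$. An integer-valued function $\gamma$ of pairs of bound colours satisfies Condition 2 if for all $c_1=a_{k_1}b_{\ell_1}$,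 $c_2=a_{k_2}b_{\ell_2}$ with $k_1\ne\ell_1$, $k_2\ne\ell_2$: * if $\max\{k_1,\ell_2\}<\min\{k_2,\ell_1\}$, then $\max\{k_1,\ell_2\}<\gamma(c_1,c_2)\le\min\{k_2,\ell_1\}$; * if $k_1>\ell_1$, $k_2>\ell_2$ and $A:=\{\ell_2+1,\dots,k_2\}\setminus\{\ell_1+1,\dots,k_1\}\ne\emptyset$, then $\gamma(c_1,c_2)\in A$; * if $k_1<\ell_1$, $k_2<\ell_2$ and $B:=\{k_1+1,\dots,\ell_1\}\setminus\{k_2+1,\dots,\ell_2\}\ne\emptyset$, then $\gamma(c_1,c_2)\in B$. Given such $\delta,\gamma$, let $\mathcal C_n(\delta,\gamma)$ be the set of $\lambda\in\mathcal P_n$ that have no part coloured $a_0b_0$ and in which none of the following occurs as a block of consecutive parts ($p\ge1$ arbitrary, $c_1=a_{k_1}b_{\ell_1}$, $c_2=a_{k_2}b_{\ell_2}$): * $p_{a_ib_i}+p_{a_ib_i}$ with $1\le i\le n-1$; * $p_{c_1}+p_{a_ib_i}+p_{c_2}$ with $\max\{k_1,\ell_2\}<\min\{k_2,\ell_1\}$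 and $i=\gamma(c_1,c_2)$; * for $k_2>\ell_2$: * $(p+u)_{c_1}+p_{a_ib_i}+p_{c_2}$ with $u\ge2$, $c_1$ any colour and $i=\delta(c_2)$; also $p_{a_ib_i}+p_{c_2}$ with $i=\delta(c_2)$ when this block is at the beginning of $\lambda$; * $(p+1)_{c_1}+p_{a_ib_i}+p_{c_2}$ with $k_1\le\ell_1$ and $i=\delta(c_2)$; * $(p+1)_{c_1}+p_{a_ib_i}+p_{c_2}$ with $k_1>\ell_1$, $\{\ell_2+1,\dots,k_2\}\setminus\{\ell_1+1,\dots,k_1\}\ne\emptyset$ and $i=\gamma(c_1,c_2)$; * for $k_1<\ell_1$: * $(p+u)_{c_1}+(p+u)_{a_ib_i}+p_{c_2}$ with $u\ge2$, $c_2$ any colour and $i=\delta(c_1)$; also $p_{c_1}+p_{a_ib_i}$ with $i=\delta(c_1)$ when this block is at the end of $\lambda$; * $(p+1)_{c_1}+(p+1)_{a_ib_i}+p_{c_2}$ with $k_2\ge\ell_2$ and $i=\delta(c_1)$; * $(p+1)_{c_1}+(p+1)_{a_ib_i}+p_{c_2}$ with $k_2<\ell_2$, $\{k_1+1,\dots,\ell_1\}\setminus\{k_2+1,\dots,\ell_2\}\ne\emptyset$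 and $i=\gamma(c_1,c_2)$. **Theorem.** For every positive integer $n$ and all functions $\delta$ and $\gamma$ satisfying Conditions 1 and 2 respectively, there is a bijection $\Phi:\mathcal P_n\to\mathcal C_n(\delta,\gamma)\times\mathcal P^0$ that preserves the weight, the number of parts, the sizes of the parts and the number of appearances of each bound colour: if $\Phi(\lambda)=(\mu,\nu)$, then the sum of the parts of $\lambda$ is the sum of all parts of $\mu$ and $\nu$, the number of parts of $\lambda$ is the total number of parts of $\mu$ and $\nu$, the multiset of sizes of the parts of $\lambda$ is the union (with multiplicity) of those of $\mu$ and $\nu$, and for each bound colour $c$ the number of parts coloured $c$ in $\lambda$ is the total number of parts coloured $c$ in $\mu$ and $\nu$. -/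

import Mathlib

namespace GenPrimc

/-- The colour `a_k b_ℓ` is the pair `(k, ℓ)` of natural numbers. -/
abbrev Colour : Type := ℕ × ℕ

/-- The free colour `a_i b_i`. -/
def freeColour (i : ℕ) : Colour := (i, i)

/-- The bound colours are the colours `a_k b_ℓ` with `k ≠ ℓ`. -/
abbrev BoundColour : Type := {c : Colour // c.1 ≠ c.2}

/-- A coloured part: a size together with a colour. -/
structure Part where
  size : ℕ
  colour : Colour

/-- A coloured partition: a finite (possibly empty) non-increasing sequence of positive integers,
each of which carries a colour. -/
def IsPartition (lam : List Part) : Prop :=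
  (∀ x ∈ lam, 0 < x.size) ∧ lam.Pairwise (fun x y => y.size ≤ x.size)

/-- The weight, that is, the sum of the sizes of the parts. -/
def weight (lam : List Part) : ℕ := (lam.map Part.size).sum

/-- The multiset of the sizes of the parts. -/
def sizes (lam : List Part) : Multiset ℕ := (lam.map Part.size : List ℕ)

/-- The number of parts that have colour `c`. -/
def colourCount (c : Colour) (lam : List Part) : ℕ := lam.countP (fun x => x.colour = c)

/-- The truth value of a proposition, as an integer. -/
def chi (P : Prop) [Decidable P] : ℤ := if P then 1 else 0

/-- The minimal difference `Δ(a_i b_k, a_{i'} b_{k'})`, where `c = (i, k)` and `d = (i', k')`. -/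
def Delta (c d : Colour) : ℤ :=
  chi (c.1 ≥ d.1) - chi (c.1 = c.2 ∧ c.2 = d.1) + chi (c.2 ≤ d.2) - chi (c.2 = d.1 ∧ d.1 = d.2)

/-- The set `P_n` of generalised Primc partitions. -/
def primc (n : ℕ) : Set (List Part) :=
  {lam | IsPartition lam ∧
    (∀ x ∈ lam, x.colour.1 < n ∧ x.colour.2 < n) ∧
    lam.IsChain (fun x y => Delta x.colour y.colour ≤ (x.size : ℤ) - (y.size : ℤ))}

/-- The set `P^0` of ordinary partitions, all parts being coloured `a_0 b_0`. -/
def classical : Set (List Part) :=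
  {lam | IsPartition lam ∧ ∀ x ∈ lam, x.colour = freeColour 0}

/-- Condition 1 on an integer-valued function of the bound colours. -/
def Condition1 (δ : BoundColour → ℤ) : Prop :=
  ∀ (k l : ℕ) (h : k ≠ l),
    ((min k l : ℕ) : ℤ) < δ ⟨(k, l), h⟩ ∧ δ ⟨(k, l), h⟩ ≤ ((max k l : ℕ) : ℤ)

/-- The set of integers `{l + 1, …, k}` (empty if `k ≤ l`). -/
def ioc (l k : ℕ) : Set ℤ := Set.Ioc (l : ℤ) (k : ℤ)

/-- Condition 2 on an integer-valued function of the pairs of bound colours. -/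
def Condition2 (γ : BoundColour → BoundColour → ℤ) : Prop :=
  ∀ (k₁ l₁ k₂ l₂ : ℕ) (h₁ : k₁ ≠ l₁) (h₂ : k₂ ≠ l₂),
    (max k₁ l₂ < min k₂ l₁ →
      ((max k₁ l₂ : ℕ) : ℤ) < γ ⟨(k₁, l₁), h₁⟩ ⟨(k₂, l₂), h₂⟩ ∧
        γ ⟨(k₁, l₁), h₁⟩ ⟨(k₂, l₂), h₂⟩ ≤ ((min k₂ l₁ : ℕ) : ℤ)) ∧
    (k₁ > l₁ → k₂ > l₂ → (ioc l₂ k₂ \ ioc l₁ k₁).Nonempty →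
      γ ⟨(k₁, l₁), h₁⟩ ⟨(k₂, l₂), h₂⟩ ∈ ioc l₂ k₂ \ ioc l₁ k₁) ∧
    (k₁ < l₁ → k₂ < l₂ → (ioc k₁ l₁ \ ioc k₂ l₂).Nonempty →
      γ ⟨(k₁, l₁), h₁⟩ ⟨(k₂, l₂), h₂⟩ ∈ ioc k₁ l₁ \ ioc k₂ l₂)

/-- The patterns that may not occur anywhere in a generalised Capparelli partition. -/
inductive Forbidden (n : ℕ) (δ : BoundColour → ℤ) (γ : BoundColour → BoundColour → ℤ) :
    List Part → Prop
  /-- `p_{a_i b_i} + p_{a_i b_i}` -/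
  | repeated (p i : ℕ) (hi : 1 ≤ i) (hin : i ≤ n - 1) :
      Forbidden n δ γ [⟨p, freeColour i⟩, ⟨p, freeColour i⟩]
  /-- `p_{c₁} + p_{a_i b_i} + p_{c₂}` -/
  | between (p i : ℕ) (k₁ l₁ k₂ l₂ : ℕ) (h₁ : k₁ ≠ l₁) (h₂ : k₂ ≠ l₂)
      (h : max k₁ l₂ < min k₂ l₁) (hi : (i : ℤ) = γ ⟨(k₁, l₁), h₁⟩ ⟨(k₂, l₂), h₂⟩) :
      Forbidden n δ γ [⟨p, (k₁, l₁)⟩, ⟨p, freeColour i⟩, ⟨p, (k₂, l₂)⟩]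
  /-- `(p+u)_{c₁} + p_{a_i b_i} + p_{c₂}`, where `2 ≤ u < ∞` -/
  | left_far (p u i : ℕ) (k₁ l₁ k₂ l₂ : ℕ) (h₂ : k₂ ≠ l₂)
      (hgt : k₂ > l₂) (hu : 2 ≤ u) (hi : (i : ℤ) = δ ⟨(k₂, l₂), h₂⟩) :
      Forbidden n δ γ [⟨p + u, (k₁, l₁)⟩, ⟨p, freeColour i⟩, ⟨p, (k₂, l₂)⟩]
  /-- `(p+1)_{c₁} + p_{a_i b_i} + p_{c₂}`, where `k₁ ≤ l₁` -/
  | left_near_le (p i : ℕ) (k₁ l₁ k₂ l₂ : ℕ) (h₂ : k₂ ≠ l₂)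
      (hgt : k₂ > l₂) (hle : k₁ ≤ l₁) (hi : (i : ℤ) = δ ⟨(k₂, l₂), h₂⟩) :
      Forbidden n δ γ [⟨p + 1, (k₁, l₁)⟩, ⟨p, freeColour i⟩, ⟨p, (k₂, l₂)⟩]
  /-- `(p+1)_{c₁} + p_{a_i b_i} + p_{c₂}`, where `k₁ > l₁` -/
  | left_near_gt (p i : ℕ) (k₁ l₁ k₂ l₂ : ℕ) (h₁ : k₁ ≠ l₁) (h₂ : k₂ ≠ l₂)
      (hgt : k₂ > l₂) (hgt₁ : k₁ > l₁) (hne : (ioc l₂ k₂ \ ioc l₁ k₁).Nonempty)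
      (hi : (i : ℤ) = γ ⟨(k₁, l₁), h₁⟩ ⟨(k₂, l₂), h₂⟩) :
      Forbidden n δ γ [⟨p + 1, (k₁, l₁)⟩, ⟨p, freeColour i⟩, ⟨p, (k₂, l₂)⟩]
  /-- `(p+u)_{c₁} + (p+u)_{a_i b_i} + p_{c₂}`, where `2 ≤ u < ∞` -/
  | right_far (p u i : ℕ) (k₁ l₁ k₂ l₂ : ℕ) (h₁ : k₁ ≠ l₁)
      (hlt : k₁ < l₁) (hu : 2 ≤ u) (hi : (i : ℤ) = δ ⟨(k₁, l₁), h₁⟩) :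
      Forbidden n δ γ [⟨p + u, (k₁, l₁)⟩, ⟨p + u, freeColour i⟩, ⟨p, (k₂, l₂)⟩]
  /-- `(p+1)_{c₁} + (p+1)_{a_i b_i} + p_{c₂}`, where `k₂ ≥ l₂` -/
  | right_near_ge (p i : ℕ) (k₁ l₁ k₂ l₂ : ℕ) (h₁ : k₁ ≠ l₁)
      (hlt : k₁ < l₁) (hge : k₂ ≥ l₂) (hi : (i : ℤ) = δ ⟨(k₁, l₁), h₁⟩) :
      Forbidden n δ γ [⟨p + 1, (k₁, l₁)⟩, ⟨p + 1, freeColour i⟩, ⟨p, (k₂, l₂)⟩]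
  /-- `(p+1)_{c₁} + (p+1)_{a_i b_i} + p_{c₂}`, where `k₂ < l₂` -/
  | right_near_lt (p i : ℕ) (k₁ l₁ k₂ l₂ : ℕ) (h₁ : k₁ ≠ l₁) (h₂ : k₂ ≠ l₂)
      (hlt : k₁ < l₁) (hlt₂ : k₂ < l₂) (hne : (ioc k₁ l₁ \ ioc k₂ l₂).Nonempty)
      (hi : (i : ℤ) = γ ⟨(k₁, l₁), h₁⟩ ⟨(k₂, l₂), h₂⟩) :
      Forbidden n δ γ [⟨p + 1, (k₁, l₁)⟩, ⟨p + 1, freeColour i⟩, ⟨p, (k₂, l₂)⟩]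

/-- The patterns that may not occur at the beginning of a generalised Capparelli partition:
`p_{a_i b_i} + p_{c₂}` (the case `u = ∞` of the constructor `left_far` above). -/
inductive ForbiddenStart (δ : BoundColour → ℤ) : List Part → Prop
  | mk (p i : ℕ) (k₂ l₂ : ℕ) (h₂ : k₂ ≠ l₂)
      (hgt : k₂ > l₂) (hi : (i : ℤ) = δ ⟨(k₂, l₂), h₂⟩) :
      ForbiddenStart δ [⟨p, freeColour i⟩, ⟨p, (k₂, l₂)⟩]

/-- The patterns that may not occur at the end of a generalised Capparelli partition:
`p_{c₁} + p_{a_i b_i}` (the case `u = ∞` of the constructor `right_far` above). -/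
inductive ForbiddenEnd (δ : BoundColour → ℤ) : List Part → Prop
  | mk (p i : ℕ) (k₁ l₁ : ℕ) (h₁ : k₁ ≠ l₁)
      (hlt : k₁ < l₁) (hi : (i : ℤ) = δ ⟨(k₁, l₁), h₁⟩) :
      ForbiddenEnd δ [⟨p, (k₁, l₁)⟩, ⟨p, freeColour i⟩]

/-- The set `C_n(δ, γ)` of generalised Capparelli partitions. A partition contains a pattern if the
pattern is a block of consecutive parts (`<:+:`); `<+:` and `<:+` say that this block is at the
beginning, respectively at the end. -/
def capparelli (n : ℕ) (δ : BoundColour → ℤ) (γ : BoundColour → BoundColour → ℤ) :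
    Set (List Part) :=
  {lam | lam ∈ primc n ∧
    (∀ x ∈ lam, x.colour ≠ freeColour 0) ∧
    (∀ π, Forbidden n δ γ π → ¬ π <:+: lam) ∧
    (∀ π, ForbiddenStart δ π → ¬ π <+: lam) ∧
    (∀ π, ForbiddenEnd δ π → ¬ π <:+ lam)}

end GenPrimc

namespace GenPrimc

/-! `Delta` satisfies a triangle inequality (`Delta_triangle`), so `Before` is transitive and
antisymmetric, and only free parts stand in this relation to themselves. Hence a Primc partition is
determined by its multiset of parts, and a multiset of admissible parts can be arranged as one
exactly when any two entries are `Compatible`. Bound parts then occur at most once, and the free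
parts of one size share a single colour, since different free parts of equal size are incompatible.

Fix the bound parts and a size `p`. Whether a free part of size `p` and colour index `i` is
compatible with them depends only on the last relevant bound part before it and the first one after
it. Each requires `i` to lie in an interval or to avoid one. The functions δ and γ select one
admissible index, with 0 as the choice when no bound part of size `p` occurs; this is `excluded`,
and `compatible_excluded` shows that it is admissible. The forbidden patterns say precisely that no
free part has the excluded colour: `capparelli` consists of the duplicate-free Primc partitions with
this property (`ne_excluded_of_mem_capparelli`, `nodup_of_mem_capparelli`,
`mem_capparelli_of_ne_excluded`).

The bijection keeps every bound part and one copy of each free part whose colour is not excluded;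
the remaining free parts are recoloured `a_0 b_0`. Conversely, a classical part of size `p` receives
the colour of the free part of size `p` already present, or the excluded colour if there is none.
Both directions leave the bound parts, and hence `excluded`, unchanged. -/

noncomputable instance : DecidableEq Part := Classical.decEq _

/-! ### The order on coloured parts -/

/-- The relation that consecutive parts of a generalised Primc partition satisfy. -/
def Before (x y : Part) : Prop := Delta x.colour y.colour ≤ (x.size : ℤ) - (y.size : ℤ)

/-- `Delta` takes only the values 0, 1, 2. This linear form lets `omega` settle every later
comparison of parts. -/
theorem before_iff (x y : Part) : Before x y ↔
    y.size + 2 ≤ x.size ∨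
    (x.size = y.size + 1 ∧
      (x.colour.1 < y.colour.1 ∨ (x.colour.1 = x.colour.2 ∧ x.colour.2 = y.colour.1) ∨
        y.colour.2 < x.colour.2 ∨ (x.colour.2 = y.colour.1 ∧ y.colour.1 = y.colour.2))) ∨
    (x.size = y.size ∧
      (x.colour.1 < y.colour.1 ∨ (x.colour.1 = x.colour.2 ∧ x.colour.2 = y.colour.1)) ∧
      (y.colour.2 < x.colour.2 ∨ (x.colour.2 = y.colour.1 ∧ y.colour.1 = y.colour.2))) := by
  simp only [Before, Delta, chi]
  split_ifs <;> omega

/-- Each subtracted `chi` implies the added one beside it, so `Delta` is a sum of two 0-1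
indicators, and the triangle inequality can be checked for each separately. -/
theorem Delta_eq (c d : Colour) : Delta c d =
    (if d.1 ≤ c.1 ∧ ¬ (c.1 = c.2 ∧ c.2 = d.1) then 1 else 0) +
      if c.2 ≤ d.2 ∧ ¬ (c.2 = d.1 ∧ d.1 = d.2) then 1 else 0 := by
  simp only [Delta, chi]
  split_ifs <;> omega

theorem Delta_triangle (c d e : Colour) : Delta c e ≤ Delta c d + Delta d e := by
  have h₁ : (if e.1 ≤ c.1 ∧ ¬ (c.1 = c.2 ∧ c.2 = e.1) then 1 else 0 : ℤ) ≤
      (if d.1 ≤ c.1 ∧ ¬ (c.1 = c.2 ∧ c.2 = d.1) then 1 else 0) +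
        if e.1 ≤ d.1 ∧ ¬ (d.1 = d.2 ∧ d.2 = e.1) then 1 else 0 := by
    split_ifs <;> omega
  have h₂ : (if c.2 ≤ e.2 ∧ ¬ (c.2 = e.1 ∧ e.1 = e.2) then 1 else 0 : ℤ) ≤
      (if c.2 ≤ d.2 ∧ ¬ (c.2 = d.1 ∧ d.1 = d.2) then 1 else 0) +
        if d.2 ≤ e.2 ∧ ¬ (d.2 = e.1 ∧ e.1 = e.2) then 1 else 0 := by
    split_ifs <;> omega
  rw [Delta_eq, Delta_eq, Delta_eq]
  linarith

theorem Before.trans {x y z : Part} (h₁ : Before x y) (h₂ : Before y z) : Before x z := by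
  have := Delta_triangle x.colour y.colour z.colour
  simp only [Before] at *
  linarith

instance : Trans Before Before Before := ⟨Before.trans⟩

theorem Part.ext' {x y : Part} (h : x.size = y.size) (h₁ : x.colour.1 = y.colour.1)
    (h₂ : x.colour.2 = y.colour.2) : x = y := by
  obtain ⟨p, k, l⟩ := x
  obtain ⟨q, k', l'⟩ := y
  simp_all

theorem Before.antisymm {x y : Part} (h₁ : Before x y) (h₂ : Before y x) : x = y := by
  rw [before_iff] at h₁ h₂
  apply Part.ext' <;> omega

theorem Before.size_le {x y : Part} (h : Before x y) : y.size ≤ x.size := by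
  rw [before_iff] at h; omega

theorem before_self_iff (x : Part) : Before x x ↔ x.colour.1 = x.colour.2 := by
  rw [before_iff]; omega

theorem mem_primc_iff {n : ℕ} {lam : List Part} : lam ∈ primc n ↔
    (∀ x ∈ lam, 0 < x.size) ∧ (∀ x ∈ lam, x.colour.1 < n ∧ x.colour.2 < n) ∧
      lam.Pairwise Before := by
  have : lam.IsChain (fun x y => Delta x.colour y.colour ≤ (x.size : ℤ) - (y.size : ℤ)) ↔
      lam.Pairwise Before := List.isChain_iff_pairwise (R := Before)
  simp only [primc, IsPartition, Set.mem_ofPred_eq, this]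
  constructor
  · rintro ⟨⟨h, -⟩, h'⟩; exact ⟨h, h'⟩
  · rintro ⟨h, h'⟩; exact ⟨⟨h, h'.2.imp Before.size_le⟩, h'⟩

/-! ### Compatibility and the bound parts that constrain a free part -/

/-- Two parts can occur in the same generalised Primc partition. -/
def Compatible (x y : Part) : Prop := Before x y ∨ Before y x

theorem Compatible.symm {x y : Part} (h : Compatible x y) : Compatible y x := Or.symm h

instance : Std.Symm Compatible := ⟨fun _ _ => Compatible.symm⟩

theorem compatible_of_mem {lam : List Part} (h : lam.Pairwise Before) {x y : Part} (hx : x ∈ lam)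
    (hy : y ∈ lam) (hxy : x ≠ y) : Compatible x y :=
  (h.imp (S := Compatible) Or.inl).forall hx hy hxy

/-- The part `p_{a_k b_ℓ}` with `k < ℓ`, or the part `(p+1)_{a_k b_ℓ}` with `k > ℓ`: the bound
parts before a free part of size `p` that restrict its colour. -/
def LeftRelevant (p : ℕ) (x : Part) : Prop :=
  (x.size = p ∧ x.colour.1 < x.colour.2) ∨ (x.size = p + 1 ∧ x.colour.2 < x.colour.1)

/-- The bound parts after a free part of size `p` that restrict its colour. -/
def RightRelevant (p : ℕ) (x : Part) : Prop :=
  (x.size = p ∧ x.colour.2 < x.colour.1) ∨ (x.size + 1 = p ∧ x.colour.1 < x.colour.2)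

theorem leftRelevant_mk (p q k l : ℕ) :
    LeftRelevant p ⟨q, k, l⟩ ↔ (q = p ∧ k < l) ∨ (q = p + 1 ∧ l < k) := Iff.rfl

theorem rightRelevant_mk (p q k l : ℕ) :
    RightRelevant p ⟨q, k, l⟩ ↔ (q = p ∧ l < k) ∨ (q + 1 = p ∧ k < l) := Iff.rfl

instance (p : ℕ) : DecidablePred (LeftRelevant p) := fun _ => inferInstanceAs (Decidable (_ ∨ _))

instance (p : ℕ) : DecidablePred (RightRelevant p) := fun _ => inferInstanceAs (Decidable (_ ∨ _))

/-- The values of `δ` as natural numbers. -/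
def deltaNat (δ : BoundColour → ℤ) (c : Colour) : ℕ :=
  if h : c.1 ≠ c.2 then (δ ⟨c, h⟩).toNat else 0

/-- The values of `γ` as natural numbers. -/
def gammaNat (γ : BoundColour → BoundColour → ℤ) (c d : Colour) : ℕ :=
  if h : c.1 ≠ c.2 ∧ d.1 ≠ d.2 then (γ ⟨c, h.1⟩ ⟨d, h.2⟩).toNat else 0

/-- The colour forbidden for a free part of size `p` whose relevant bound neighbours are given. -/
def excludedBetween (δ : BoundColour → ℤ) (γ : BoundColour → BoundColour → ℤ) (p : ℕ) :
    Option Part → Option Part → ℕ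
  | some x, some y => if x.size = p ∨ y.size = p then gammaNat γ x.colour y.colour else 0
  | some x, none => if x.size = p then deltaNat δ x.colour else 0
  | none, some y => if y.size = p then deltaNat δ y.colour else 0
  | none, none => 0

/-- The index of the free colour that is forbidden at size `p`, given the bound parts. -/
def excluded (δ : BoundColour → ℤ) (γ : BoundColour → BoundColour → ℤ) (lam : List Part)
    (p : ℕ) : ℕ :=
  excludedBetween δ γ p (lam.filter (LeftRelevant p)).getLast? (lam.filter (RightRelevant p)).head?

/-! ### The values of δ and γ as natural numbers -/

section values

variable {δ : BoundColour → ℤ} {γ : BoundColour → BoundColour → ℤ}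

theorem deltaNat_spec (hδ : Condition1 δ) {k l : ℕ} (h : k ≠ l) :
    (deltaNat δ (k, l) : ℤ) = δ ⟨(k, l), h⟩ ∧ min k l < deltaNat δ (k, l) ∧
      deltaNat δ (k, l) ≤ max k l := by
  have := hδ k l h
  have e : deltaNat δ (k, l) = (δ ⟨(k, l), h⟩).toNat := dif_pos h
  omega

/-- In the three constrained cases γ is positive, so `toNat` loses nothing; elsewhere γ is
arbitrary. -/
theorem gammaNat_spec (hγ : Condition2 γ) {k₁ l₁ k₂ l₂ : ℕ} (h₁ : k₁ ≠ l₁) (h₂ : k₂ ≠ l₂) :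
    (max k₁ l₂ < min k₂ l₁ →
      (gammaNat γ (k₁, l₁) (k₂, l₂) : ℤ) = γ ⟨(k₁, l₁), h₁⟩ ⟨(k₂, l₂), h₂⟩ ∧
      max k₁ l₂ < gammaNat γ (k₁, l₁) (k₂, l₂) ∧
        gammaNat γ (k₁, l₁) (k₂, l₂) ≤ min k₂ l₁) ∧
    (l₁ < k₁ → l₂ < k₂ → (ioc l₂ k₂ \ ioc l₁ k₁).Nonempty →
      (gammaNat γ (k₁, l₁) (k₂, l₂) : ℤ) = γ ⟨(k₁, l₁), h₁⟩ ⟨(k₂, l₂), h₂⟩ ∧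
      (l₂ < gammaNat γ (k₁, l₁) (k₂, l₂) ∧ gammaNat γ (k₁, l₁) (k₂, l₂) ≤ k₂) ∧
        ¬ (l₁ < gammaNat γ (k₁, l₁) (k₂, l₂) ∧ gammaNat γ (k₁, l₁) (k₂, l₂) ≤ k₁)) ∧
    (k₁ < l₁ → k₂ < l₂ → (ioc k₁ l₁ \ ioc k₂ l₂).Nonempty →
      (gammaNat γ (k₁, l₁) (k₂, l₂) : ℤ) = γ ⟨(k₁, l₁), h₁⟩ ⟨(k₂, l₂), h₂⟩ ∧
      (k₁ < gammaNat γ (k₁, l₁) (k₂, l₂) ∧ gammaNat γ (k₁, l₁) (k₂, l₂) ≤ l₁) ∧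
        ¬ (k₂ < gammaNat γ (k₁, l₁) (k₂, l₂) ∧ gammaNat γ (k₁, l₁) (k₂, l₂) ≤ l₂)) := by
  obtain ⟨a, b, c⟩ := hγ k₁ l₁ k₂ l₂ h₁ h₂
  have e : gammaNat γ (k₁, l₁) (k₂, l₂) = (γ ⟨(k₁, l₁), h₁⟩ ⟨(k₂, l₂), h₂⟩).toNat :=
    dif_pos ⟨h₁, h₂⟩
  simp only [ioc, Set.mem_sdiff, Set.mem_Ioc] at a b c ⊢
  refine ⟨fun h => ?_, fun h h' h'' => ?_, fun h h' h'' => ?_⟩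
  · have := a h; omega
  · have := b h h' h''; omega
  · have := c h h' h''; omega

/-- A nonempty interval not contained in another sticks out at its first or last element. -/
theorem ioc_diff_nonempty_iff {a b c d : ℕ} (h : a < b) :
    (ioc a b \ ioc c d).Nonempty ↔ a < c ∨ d < b := by
  simp only [ioc, Set.Nonempty, Set.mem_sdiff, Set.mem_Ioc]
  constructor
  · rintro ⟨x, hx⟩; omega
  · rintro (h | h)
    · exact ⟨a + 1, by omega⟩
    · exact ⟨b, by omega⟩

end values

/-! ### Which free colours a bound part allows -/

/-- A free part. -/
def freePart (p i : ℕ) : Part := ⟨p, freeColour i⟩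

theorem leftRelevant_before {p : ℕ} {x : Part} (hx : LeftRelevant p x) (i : ℕ) :
    Before x (freePart p i) ↔
      if x.size = p then x.colour.1 < i ∧ i ≤ x.colour.2
      else ¬ (x.colour.2 < i ∧ i ≤ x.colour.1) := by
  rw [before_iff]
  simp only [LeftRelevant, freePart, freeColour, and_true] at *
  split_ifs <;> omega

theorem before_rightRelevant {p : ℕ} {y : Part} (hy : RightRelevant p y) (i : ℕ) :
    Before (freePart p i) y ↔
      if y.size = p then y.colour.2 < i ∧ i ≤ y.colour.1
      else ¬ (y.colour.1 < i ∧ i ≤ y.colour.2) := by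
  rw [before_iff]
  simp only [RightRelevant, freePart, freeColour, true_and] at *
  split_ifs <;> omega

/-- A bound part of size `p` is always relevant. One of size `p + 1` with `k < ℓ` may precede any
`a_i b_i`, since `k < i` or `i < ℓ`; size `p - 1` with `k > ℓ` is symmetric. -/
theorem compatible_of_not_relevant {p : ℕ} {x : Part} (hx : x.colour.1 ≠ x.colour.2)
    (hl : ¬ LeftRelevant p x) (hr : ¬ RightRelevant p x) (i : ℕ) :
    Compatible x (freePart p i) := by
  simp only [Compatible, before_iff, LeftRelevant, RightRelevant, freePart, freeColour, and_true, true_and] at *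
  omega

theorem compatible_freePart (p q i j : ℕ) (h : p = q → i = j) :
    Compatible (freePart p i) (freePart q j) := by
  simp only [Compatible, before_iff, freePart, freeColour, and_true, true_and] at *
  omega

theorem before_of_leftRelevant_of_rightRelevant {p : ℕ} {x y : Part} (hx : LeftRelevant p x)
    (hy : RightRelevant p y) (h : Compatible x y) : Before x y := by
  simp only [Compatible, before_iff, LeftRelevant, RightRelevant] at *
  omega

theorem before_of_mem_getLast? {lam : List Part} (h : lam.Pairwise Before) {x y : Part}
    (hy : lam.getLast? = some y) (hx : x ∈ lam) : x = y ∨ Before x y := by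
  obtain ⟨l, rfl⟩ := List.getLast?_eq_some_iff.1 hy
  rw [List.pairwise_append] at h
  rcases List.mem_append.1 hx with hx | hx
  · exact Or.inr (h.2.2 x hx y (by simp))
  · exact Or.inl (by simpa using hx)

theorem before_of_mem_head? {lam : List Part} (h : lam.Pairwise Before) {x y : Part}
    (hy : lam.head? = some y) (hx : x ∈ lam) : x = y ∨ Before y x := by
  obtain ⟨l, rfl⟩ := List.head?_eq_some_iff.1 hy
  rw [List.pairwise_cons] at h
  rcases List.mem_cons.1 hx with hx | hx
  · exact Or.inl hx
  · exact Or.inr (h.1 x hx)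

/-! ### Admissibility of the excluded colour -/

section excluded

variable {δ : BoundColour → ℤ} {γ : BoundColour → BoundColour → ℤ} {n : ℕ}

/-- The conditions on δ and γ are tailored to this. When at least one of two relevant parts has size
`p`, `Before x y` says exactly that the intersection or difference of intervals from which γ chooses
is nonempty. -/
theorem excludedBetween_before (hδ : Condition1 δ) (hγ : Condition2 γ) {p : ℕ}
    {o₁ o₂ : Option Part} (h₁ : ∀ x ∈ o₁, LeftRelevant p x) (h₂ : ∀ y ∈ o₂, RightRelevant p y)
    (h : ∀ x ∈ o₁, ∀ y ∈ o₂, Before x y) :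
    (∀ x ∈ o₁, Before x (freePart p (excludedBetween δ γ p o₁ o₂))) ∧
      ∀ y ∈ o₂, Before (freePart p (excludedBetween δ γ p o₁ o₂)) y := by
  rcases o₁ with _ | ⟨q, k, l⟩ <;> rcases o₂ with _ | ⟨q', k', l'⟩ <;>
    simp only [Option.mem_def, reduceCtorEq, false_imp_iff, implies_true, Option.some.injEq,
      forall_eq', true_and, and_true] at *
  · rw [before_rightRelevant h₂]
    simp only [excludedBetween, RightRelevant] at *
    split_ifs with e
    · have := deltaNat_spec hδ (k := k') (l := l') (by omega)
      omega
    · omega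
  · rw [leftRelevant_before h₁]
    simp only [excludedBetween, LeftRelevant] at *
    split_ifs with e
    · have := deltaNat_spec hδ (k := k) (l := l) (by omega)
      omega
    · omega
  · rw [leftRelevant_before h₁, before_rightRelevant h₂]
    rw [before_iff] at h
    simp only [excludedBetween, LeftRelevant, RightRelevant] at *
    obtain ⟨a, b, c⟩ := gammaNat_spec hγ (k₁ := k) (l₁ := l) (k₂ := k') (l₂ := l')
      (by omega) (by omega)
    by_cases e : q = p <;> by_cases e' : q' = p <;>
      simp only [e, e', if_true, if_false, or_true, true_or, or_self]
    · have := a (by omega); omega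
    · have := c (by omega) (by omega)
        ((ioc_diff_nonempty_iff (by omega)).2 (by omega))
      omega
    · have := b (by omega) (by omega)
        ((ioc_diff_nonempty_iff (by omega)).2 (by omega))
      omega
    -- Sizes `p + 1` and `p - 1`: both constraints only forbid intervals of positive integers, so
    -- index 0 is admissible.
    · omega

theorem mem_of_mem_getLast?_filter {lam : List Part} {P : Part → Prop} [DecidablePred P] {x : Part}
    (hx : x ∈ (lam.filter P).getLast?) : x ∈ lam ∧ P x := by
  simpa using List.mem_of_getLast? hx

theorem mem_of_mem_head?_filter {lam : List Part} {P : Part → Prop} [DecidablePred P] {x : Part}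
    (hx : x ∈ (lam.filter P).head?) : x ∈ lam ∧ P x := by
  simpa using List.mem_of_head? hx

/-- The excluded free colour is a possible one. -/
theorem compatible_excluded (hδ : Condition1 δ) (hγ : Condition2 γ) {lam : List Part}
    (hlam : lam.Pairwise Before) (p : ℕ) {x : Part} (hx : x ∈ lam)
    (hb : x.colour.1 ≠ x.colour.2) : Compatible x (freePart p (excluded δ γ lam p)) := by
  have key := excludedBetween_before hδ hγ (p := p)
    (o₁ := (lam.filter (LeftRelevant p)).getLast?) (o₂ := (lam.filter (RightRelevant p)).head?)
    (fun x hx => (mem_of_mem_getLast?_filter hx).2) (fun x hx => (mem_of_mem_head?_filter hx).2)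
    (fun x hx y hy => by
      obtain ⟨hx, hx'⟩ := mem_of_mem_getLast?_filter hx
      obtain ⟨hy, hy'⟩ := mem_of_mem_head?_filter hy
      refine before_of_leftRelevant_of_rightRelevant hx' hy' (compatible_of_mem hlam hx hy ?_)
      rintro rfl
      simp only [LeftRelevant, RightRelevant] at *
      omega)
  rw [← excluded] at key
  -- By transitivity, the last left relevant part and the first right relevant part impose the
  -- strongest constraints.
  by_cases hl : LeftRelevant p x
  · left
    have hm : x ∈ lam.filter (LeftRelevant p) := by simpa using ⟨hx, hl⟩
    obtain ⟨y, hy⟩ := Option.ne_none_iff_exists'.1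
      (mt List.getLast?_eq_none_iff.1 (List.ne_nil_of_mem hm))
    rcases before_of_mem_getLast? (hlam.filter _) hy hm with rfl | h
    · exact key.1 _ hy
    · exact h.trans (key.1 _ hy)
  · by_cases hr : RightRelevant p x
    · right
      have hm : x ∈ lam.filter (RightRelevant p) := by simpa using ⟨hx, hr⟩
      obtain ⟨y, hy⟩ := Option.ne_none_iff_exists'.1
        (mt List.head?_eq_none_iff.1 (List.ne_nil_of_mem hm))
      rcases before_of_mem_head? (hlam.filter _) hy hm with rfl | h
      · exact key.2 _ hy
      · exact (key.2 _ hy).trans h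
    · exact compatible_of_not_relevant hb hl hr _

theorem excluded_eq_zero {lam : List Part} {p : ℕ}
    (h : ∀ x ∈ lam, x.size = p → x.colour.1 = x.colour.2) : excluded δ γ lam p = 0 := by
  have bl : ∀ x ∈ (lam.filter (LeftRelevant p)).getLast?, x.size ≠ p := by
    intro x hx e
    obtain ⟨hx, hx'⟩ := mem_of_mem_getLast?_filter hx
    have := h x hx e
    simp only [LeftRelevant] at *
    omega
  have br : ∀ x ∈ (lam.filter (RightRelevant p)).head?, x.size ≠ p := by
    intro x hx e
    obtain ⟨hx, hx'⟩ := mem_of_mem_head?_filter hx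
    have := h x hx e
    simp only [RightRelevant] at *
    omega
  unfold excluded
  revert bl br
  generalize (lam.filter (LeftRelevant p)).getLast? = o₁
  generalize (lam.filter (RightRelevant p)).head? = o₂
  intro bl br
  rcases o₁ with _ | x <;> rcases o₂ with _ | y <;>
    simp_all [excludedBetween]

/-- A nonzero excluded index requires a bound part of size `p`, and compatibility with that part
bounds the index by its colour indices. -/
theorem excluded_lt (hn : 0 < n) (hδ : Condition1 δ) (hγ : Condition2 γ) {lam : List Part}
    (hlam : lam ∈ primc n) (p : ℕ) : excluded δ γ lam p < n := by
  obtain ⟨-, hc, hlam⟩ := mem_primc_iff.1 hlam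
  by_contra hp
  refine hp ((excluded_eq_zero fun x hx hxp => ?_).trans_lt hn)
  by_contra hb
  have hc := hc x hx
  have := compatible_excluded hδ hγ hlam p hx hb
  simp only [Compatible, before_iff, freePart, freeColour] at *
  omega

end excluded

/-! ### Reduction to the immediate neighbours of a free part -/

section neighbours

variable {lam pre post : List Part} {p i : ℕ}

/-- Within one size, parts with `k < ℓ` precede the free ones, which precede those with `k > ℓ`. So
if the immediate predecessor is not left relevant, no earlier part is. This turns the global
definition of `excluded` into a condition on consecutive parts. -/
theorem getLast?_filter_leftRelevant (h : (pre ++ freePart p i :: post).Pairwise Before)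
    (hpre : freePart p i ∉ pre) :
    ((pre ++ freePart p i :: post).filter (LeftRelevant p)).getLast? =
      pre.getLast?.filter (LeftRelevant p) := by
  rw [List.pairwise_append, List.pairwise_cons] at h
  obtain ⟨h₁, ⟨h₂, -⟩, h₃⟩ := h
  have e : (freePart p i :: post).filter (LeftRelevant p) = [] := by
    simp only [List.filter_eq_nil_iff, List.mem_cons, forall_eq_or_imp, decide_eq_true_eq]
    refine ⟨?_, fun x hx hl => ?_⟩
    · simp [LeftRelevant, freePart, freeColour]
    · have := h₂ x hx
      simp only [before_iff, LeftRelevant, freePart, freeColour, true_and] at *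
      omega
  rw [List.filter_append, e, List.append_nil]
  rcases List.eq_nil_or_concat' pre with rfl | ⟨l, y, rfl⟩
  · simp
  · by_cases hy : LeftRelevant p y
    · simp [hy, Option.filter]
    · have : l.filter (LeftRelevant p) = [] := by
        simp only [List.filter_eq_nil_iff, decide_eq_true_eq]
        intro x hx hl
        have a : Before x y := (List.pairwise_append.1 h₁).2.2 x hx y (by simp)
        have b : Before y (freePart p i) := h₃ y (by simp) _ (by simp)
        have c : y ≠ freePart p i := by rintro rfl; simp at hpre
        apply c
        rw [before_iff] at a b
        simp only [LeftRelevant, freePart, freeColour, and_true] at *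
        apply Part.ext' <;> simp only <;> omega
      simp [this, hy, Option.filter]

theorem head?_filter_rightRelevant (h : (pre ++ freePart p i :: post).Pairwise Before)
    (hpost : freePart p i ∉ post) :
    ((pre ++ freePart p i :: post).filter (RightRelevant p)).head? =
      post.head?.filter (RightRelevant p) := by
  rw [List.pairwise_append, List.pairwise_cons] at h
  obtain ⟨-, ⟨h₁, h₂⟩, h₃⟩ := h
  have e : pre.filter (RightRelevant p) = [] := by
    simp only [List.filter_eq_nil_iff, decide_eq_true_eq]
    intro x hx hr
    have := h₃ x hx _ (List.mem_cons_self ..)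
    simp only [before_iff, RightRelevant, freePart, freeColour, and_true] at *
    omega
  have e' : ¬ RightRelevant p (freePart p i) := by
    simp [RightRelevant, freePart, freeColour]
  rw [List.filter_append, e, List.nil_append, List.filter_cons_of_neg (by simpa using e')]
  rcases post with _ | ⟨y, l⟩
  · simp
  · by_cases hy : RightRelevant p y
    · simp [hy, Option.filter]
    · have : l.filter (RightRelevant p) = [] := by
        simp only [List.filter_eq_nil_iff, decide_eq_true_eq]
        intro x hx hl
        have a : Before y x := (List.pairwise_cons.1 h₂).1 x hx
        have b : Before (freePart p i) y := h₁ y (by simp)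
        have c : y ≠ freePart p i := by rintro rfl; simp at hpost
        apply c
        rw [before_iff] at a b
        simp only [RightRelevant, freePart, freeColour, true_and] at *
        apply Part.ext' <;> simp only <;> omega
      simp [this, hy, Option.filter]

theorem excluded_eq_neighbours {δ : BoundColour → ℤ} {γ : BoundColour → BoundColour → ℤ}
    (h : (pre ++ freePart p i :: post).Pairwise Before)
    (hpre : freePart p i ∉ pre) (hpost : freePart p i ∉ post) :
    excluded δ γ (pre ++ freePart p i :: post) p =
      excludedBetween δ γ p (pre.getLast?.filter (LeftRelevant p))
        (post.head?.filter (RightRelevant p)) := by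
  rw [excluded, getLast?_filter_leftRelevant h hpre, head?_filter_rightRelevant h hpost]

end neighbours

/-! ### Capparelli partitions as partitions avoiding the excluded colours -/

theorem Before.trans_ne {x y z : Part} (h₁ : Before x y ∧ x ≠ y) (h₂ : Before y z ∧ y ≠ z) :
    Before x z ∧ x ≠ z := by
  refine ⟨h₁.1.trans h₂.1, ?_⟩
  rintro rfl
  exact h₁.2 (h₁.1.antisymm h₂.1)

/-- Strict `Before` is transitive, so it suffices that adjacent parts differ; equal adjacent parts
would be free. -/
theorem nodup_of_not_infix {lam : List Part} (h : lam.Pairwise Before)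
    (h' : ∀ p i, ¬ [freePart p i, freePart p i] <:+: lam) : lam.Nodup := by
  have : Trans (fun x y => Before x y ∧ x ≠ y) (fun x y => Before x y ∧ x ≠ y)
      (fun x y => Before x y ∧ x ≠ y) := ⟨Before.trans_ne⟩
  have hc : lam.IsChain (fun x y => Before x y ∧ x ≠ y) := by
    rw [List.isChain_iff_forall_rel_of_append_cons_cons]
    rintro a b l₁ l₂ rfl
    have hab : Before a b := by
      simp only [List.pairwise_append, List.pairwise_cons] at h
      exact h.2.1.1 b (by simp)
    refine ⟨hab, ?_⟩
    rintro rfl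
    rw [before_self_iff] at hab
    have e : a = freePart a.size a.colour.1 := Part.ext' rfl rfl hab.symm
    apply h' a.size a.colour.1
    rw [← e]
    exact ⟨l₁, l₂, by simp⟩
  exact (List.isChain_iff_pairwise.1 hc).imp And.right

section capparelli

variable {δ : BoundColour → ℤ} {γ : BoundColour → BoundColour → ℤ} {n : ℕ}

/-- The excluded index is either 0, ruled out by the absence of `a_0 b_0`, or a value of δ or γ. In
the latter case the neighbours complete a forbidden pattern. -/
theorem ne_excluded_of_mem_capparelli (hδ : Condition1 δ) (hγ : Condition2 γ)
    {pre post : List Part} {p i : ℕ}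
    (h : pre ++ freePart p i :: post ∈ capparelli n δ γ) (hd : (pre ++ freePart p i :: post).Nodup) :
    i ≠ excluded δ γ (pre ++ freePart p i :: post) p := by
  obtain ⟨hP, h0, hf, hs, he⟩ := h
  obtain ⟨-, -, hP⟩ := mem_primc_iff.1 hP
  have hpre : freePart p i ∉ pre := by
    rw [List.nodup_append] at hd
    exact fun h => hd.2.2 _ h _ (List.mem_cons_self ..) rfl
  have hpost : freePart p i ∉ post := by
    rw [List.nodup_append, List.nodup_cons] at hd
    exact hd.2.1.1
  have hi : i ≠ 0 := by
    rintro rfl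
    exact h0 (freePart p 0) (by simp) rfl
  rw [excluded_eq_neighbours hP hpre hpost]
  intro hex
  rcases List.eq_nil_or_concat' pre with rfl | ⟨l, ⟨q, k₁, l₁⟩, rfl⟩ <;>
    rcases post with _ | ⟨⟨r, k₂, l₂⟩, t⟩
  · simp [excludedBetween, hi] at hex
  · by_cases hr : RightRelevant p ⟨r, k₂, l₂⟩
    · by_cases e : r = p
      · subst e
        simp [excludedBetween, hr, Option.filter] at hex
        simp only [RightRelevant] at hr
        refine hs _ (.mk r i k₂ l₂ (by omega) (by omega) ?_) ⟨t, rfl⟩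
        rw [hex]
        exact (deltaNat_spec hδ _).1
      · simp [excludedBetween, hr, Option.filter, hi, e] at hex
    · simp [excludedBetween, hr, Option.filter, hi] at hex
  · by_cases hl : LeftRelevant p ⟨q, k₁, l₁⟩
    · by_cases e : q = p
      · subst e
        simp [excludedBetween, hl, Option.filter] at hex
        simp only [LeftRelevant] at hl
        refine he _ (.mk q i k₁ l₁ (by omega) (by omega) ?_) ⟨l, by simp [freePart]⟩
        rw [hex]
        exact (deltaNat_spec hδ _).1
      · simp [excludedBetween, hl, Option.filter, hi, e] at hex
    · simp [excludedBetween, hl, Option.filter, hi] at hex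
  · have hb₁ : Before ⟨q, k₁, l₁⟩ (freePart p i) := by
      simp only [List.pairwise_append] at hP
      exact hP.2.2 _ (by simp) _ (by simp)
    have hb₂ : Before (freePart p i) ⟨r, k₂, l₂⟩ := by
      simp only [List.pairwise_append, List.pairwise_cons] at hP
      exact hP.2.1.1 _ (by simp)
    have hb₃ : Before ⟨q, k₁, l₁⟩ ⟨r, k₂, l₂⟩ := hb₁.trans hb₂
    have hf' : ∀ a b, a = q → b = r →
        ¬ Forbidden n δ γ [⟨a, k₁, l₁⟩, freePart p i, ⟨b, k₂, l₂⟩] := by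
      rintro a b rfl rfl h
      exact hf _ h ⟨l, t, by simp⟩
    have hne₁ : q = p → k₁ = l₁ → k₁ ≠ i := by
      rintro rfl rfl rfl
      simp [freePart, freeColour] at hpre
    have hne₂ : r = p → k₂ = l₂ → k₂ ≠ i := by
      rintro rfl rfl rfl
      simp [freePart, freeColour] at hpost
    rw [before_iff] at hb₁ hb₂ hb₃
    simp only [freePart, freeColour, true_and, and_true] at hb₁ hb₂ hb₃
    by_cases hl : LeftRelevant p ⟨q, k₁, l₁⟩ <;> by_cases hr : RightRelevant p ⟨r, k₂, l₂⟩ <;>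
      simp only [excludedBetween, hr, hl, Option.filter, List.getLast?_append, List.getLast?_singleton,
        Option.some_or, List.head?_cons, decide_true, decide_false, if_true, if_false,
        Bool.false_eq_true] at hex <;>
      simp only [LeftRelevant, RightRelevant] at hl hr
    · obtain ⟨a, b, c⟩ := gammaNat_spec hγ (k₁ := k₁) (l₁ := l₁) (k₂ := k₂) (l₂ := l₂)
        (by omega) (by omega)
      by_cases e : q = p <;> by_cases e' : r = p <;>
        simp only [e, e', if_true, if_false, or_true, true_or, or_self] at hex
      · refine hf' p p e.symm e'.symm (.between p i k₁ l₁ k₂ l₂ (by omega) (by omega) (by omega) ?_)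
        rw [hex, (a (by omega)).1]
      · have hne := (ioc_diff_nonempty_iff (a := k₁) (b := l₁) (c := k₂) (d := l₂) (by omega)).2
          (by omega)
        obtain rfl : p = r + 1 := by omega
        refine hf' (r + 1) r e.symm rfl
          (.right_near_lt r i k₁ l₁ k₂ l₂ (by omega) (by omega) (by omega) (by omega) hne ?_)
        rw [hex, (c (by omega) (by omega) hne).1]
      · have hne := (ioc_diff_nonempty_iff (a := l₂) (b := k₂) (c := l₁) (d := k₁) (by omega)).2
          (by omega)
        refine hf' (p + 1) p (by omega) e'.symm
          (.left_near_gt p i k₁ l₁ k₂ l₂ (by omega) (by omega) (by omega) (by omega) hne ?_)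
        rw [hex, (b (by omega) (by omega) hne).1]
      · exact hi hex
    · by_cases e : q = p <;> simp only [e, if_true, if_false] at hex
      · have hδ' := (deltaNat_spec hδ (k := k₁) (l := l₁) (by omega)).1
        rw [← hex] at hδ'
        by_cases e' : r + 1 = p
        · obtain rfl := e'
          exact hf' (r + 1) r e.symm rfl
            (.right_near_ge r i k₁ l₁ k₂ l₂ (by omega) (by omega) (by omega) hδ')
        -- Here `u ≥ 2`: a following part of size `p` would be right relevant or a second copy of
        -- the free part.
        · obtain ⟨u, rfl⟩ : ∃ u, p = r + u := ⟨p - r, by omega⟩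
          exact hf' (r + u) r e.symm rfl
            (.right_far r u i k₁ l₁ k₂ l₂ (by omega) (by omega) (by omega) hδ')
      · exact hi hex
    · by_cases e : r = p <;> simp only [e, if_true, if_false] at hex
      · have hδ' := (deltaNat_spec hδ (k := k₂) (l := l₂) (by omega)).1
        rw [← hex] at hδ'
        by_cases e' : q = p + 1
        · exact hf' (p + 1) p e'.symm e.symm
            (.left_near_le p i k₁ l₁ k₂ l₂ (by omega) (by omega) (by omega) hδ')
        · obtain ⟨u, rfl⟩ : ∃ u, q = p + u := ⟨q - p, by omega⟩
          exact hf' (p + u) p rfl e.symm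
            (.left_far p u i k₁ l₁ k₂ l₂ (by omega) (by omega) (by omega) hδ')
      · exact hi hex
    · exact hi hex

theorem nodup_of_mem_capparelli {lam : List Part} (h : lam ∈ capparelli n δ γ) : lam.Nodup := by
  obtain ⟨hP, h0, hf, -, -⟩ := h
  obtain ⟨-, hc, hP⟩ := mem_primc_iff.1 hP
  refine nodup_of_not_infix hP fun p i hin => ?_
  have hm : freePart p i ∈ lam := hin.subset (by simp)
  have hi : i ≠ 0 := by
    rintro rfl
    exact h0 _ hm rfl
  have hin' : i < n := (hc _ hm).1
  exact hf _ (.repeated p i (by omega) (by omega)) hin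

theorem mem_capparelli_of_ne_excluded (hδ : Condition1 δ) (hγ : Condition2 γ) {lam : List Part}
    (hP : lam ∈ primc n) (hd : lam.Nodup)
    (h : ∀ p i, freePart p i ∈ lam → i ≠ excluded δ γ lam p) : lam ∈ capparelli n δ γ := by
  obtain ⟨-, -, hB⟩ := mem_primc_iff.1 hP
  have key : ∀ (pre post : List Part) (p i : ℕ), pre ++ freePart p i :: post = lam →
      i ≠ excludedBetween δ γ p (pre.getLast?.filter (LeftRelevant p))
        (post.head?.filter (RightRelevant p)) := by
    rintro pre post p i rfl
    rw [← excluded_eq_neighbours hB]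
    · exact h p i (by simp)
    · rw [List.nodup_append] at hd
      exact fun h => hd.2.2 _ h _ (List.mem_cons_self ..) rfl
    · rw [List.nodup_append, List.nodup_cons] at hd
      exact hd.2.1.1
  have key' : ∀ x y p i, [x, freePart p i, y] <:+: lam →
      i ≠ excludedBetween δ γ p ((some x).filter (LeftRelevant p))
        ((some y).filter (RightRelevant p)) := by
    rintro x y p i ⟨s, t, hst⟩
    simpa using key (s ++ [x]) (y :: t) p i (by simpa using hst)
  refine ⟨hP, ?_, ?_, ?_, ?_⟩
  · rintro ⟨p, c⟩ hx rfl
    -- No bound part of size `p` is compatible with `a_0 b_0` at size `p`, so the excluded index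
    -- there is 0.
    refine h p 0 hx (excluded_eq_zero fun y hy hyp => ?_).symm
    by_contra hne
    have := compatible_of_mem hB hx hy (by rintro rfl; exact hne rfl)
    simp only [Compatible, before_iff, freeColour] at *
    omega
  · rintro π (⟨p, i, hi, hin⟩ | ⟨p, i, k₁, l₁, k₂, l₂, h₁, h₂, hlt, hi⟩ |
      ⟨p, u, i, k₁, l₁, k₂, l₂, h₂, hgt, hu, hi⟩ | ⟨p, i, k₁, l₁, k₂, l₂, h₂, hgt, hle, hi⟩ |
      ⟨p, i, k₁, l₁, k₂, l₂, h₁, h₂, hgt, hgt₁, hne, hi⟩ |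
      ⟨p, u, i, k₁, l₁, k₂, l₂, h₁, hlt, hu, hi⟩ | ⟨p, i, k₁, l₁, k₂, l₂, h₁, hlt, hge, hi⟩ |
      ⟨p, i, k₁, l₁, k₂, l₂, h₁, h₂, hlt, hlt₂, hne, hi⟩) hin
    · simpa using hd.sublist hin.sublist
    · refine key' _ _ _ _ hin ?_
      have := ((gammaNat_spec hγ h₁ h₂).1 hlt).1
      have e₁ : LeftRelevant p ⟨p, k₁, l₁⟩ := by rw [leftRelevant_mk]; omega
      have e₂ : RightRelevant p ⟨p, k₂, l₂⟩ := by rw [rightRelevant_mk]; omega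
      simp [Option.filter, e₁, e₂, excludedBetween]
      omega
    · refine key' _ _ _ _ hin ?_
      have := (deltaNat_spec hδ h₂).1
      have e₁ : ¬ LeftRelevant p ⟨p + u, k₁, l₁⟩ := by rw [leftRelevant_mk]; omega
      have e₂ : RightRelevant p ⟨p, k₂, l₂⟩ := by rw [rightRelevant_mk]; omega
      simp [Option.filter, e₁, e₂, excludedBetween]
      omega
    · refine key' _ _ _ _ hin ?_
      have := (deltaNat_spec hδ h₂).1
      have e₁ : ¬ LeftRelevant p ⟨p + 1, k₁, l₁⟩ := by rw [leftRelevant_mk]; omega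
      have e₂ : RightRelevant p ⟨p, k₂, l₂⟩ := by rw [rightRelevant_mk]; omega
      simp [Option.filter, e₁, e₂, excludedBetween]
      omega
    · refine key' _ _ _ _ hin ?_
      have := ((gammaNat_spec hγ h₁ h₂).2.1 hgt₁ hgt hne).1
      have e₁ : LeftRelevant p ⟨p + 1, k₁, l₁⟩ := by rw [leftRelevant_mk]; omega
      have e₂ : RightRelevant p ⟨p, k₂, l₂⟩ := by rw [rightRelevant_mk]; omega
      simp [Option.filter, e₁, e₂, excludedBetween]
      omega
    · refine key' _ _ _ _ hin ?_
      have := (deltaNat_spec hδ h₁).1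
      have e₁ : LeftRelevant (p + u) ⟨p + u, k₁, l₁⟩ := by rw [leftRelevant_mk]; omega
      have e₂ : ¬ RightRelevant (p + u) ⟨p, k₂, l₂⟩ := by rw [rightRelevant_mk]; omega
      simp [Option.filter, e₁, e₂, excludedBetween]
      omega
    · refine key' _ _ _ _ hin ?_
      have := (deltaNat_spec hδ h₁).1
      have e₁ : LeftRelevant (p + 1) ⟨p + 1, k₁, l₁⟩ := by rw [leftRelevant_mk]; omega
      have e₂ : ¬ RightRelevant (p + 1) ⟨p, k₂, l₂⟩ := by rw [rightRelevant_mk]; omega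
      simp [Option.filter, e₁, e₂, excludedBetween]
      omega
    · refine key' _ _ _ _ hin ?_
      have := ((gammaNat_spec hγ h₁ h₂).2.2 hlt hlt₂ hne).1
      have e₁ : LeftRelevant (p + 1) ⟨p + 1, k₁, l₁⟩ := by rw [leftRelevant_mk]; omega
      have e₂ : RightRelevant (p + 1) ⟨p, k₂, l₂⟩ := by rw [rightRelevant_mk]; omega
      simp [Option.filter, e₁, e₂, excludedBetween]
      omega
  · rintro π ⟨p, i, k, l, hne, hgt, hi⟩ ⟨t, ht⟩
    refine key [] (⟨p, k, l⟩ :: t) p i ht ?_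
    have := (deltaNat_spec hδ hne).1
    have e : RightRelevant p ⟨p, k, l⟩ := by rw [rightRelevant_mk]; omega
    simp [Option.filter, e, excludedBetween]
    omega
  · rintro π ⟨p, i, k, l, hne, hgt, hi⟩ ⟨t, ht⟩
    refine key (t ++ [⟨p, k, l⟩]) [] p i (by simpa [freePart] using ht) ?_
    have := (deltaNat_spec hδ hne).1
    have e : LeftRelevant p ⟨p, k, l⟩ := by rw [leftRelevant_mk]; omega
    simp [Option.filter, e, excludedBetween]
    omega

end capparelli

/-! ### Uniqueness of arrangements and of free colours -/

theorem eq_freePart {x : Part} (h : x.colour.1 = x.colour.2) : x = freePart x.size x.colour.1 :=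
  Part.ext' rfl rfl h.symm

theorem eq_of_perm_of_pairwise_before {l₁ l₂ : List Part} (h₁ : l₁.Pairwise Before)
    (h₂ : l₂.Pairwise Before) (h : l₁.Perm l₂) : l₁ = l₂ :=
  h.eq_of_pairwise (fun _ _ _ _ => Before.antisymm) h₁ h₂

theorem freePart_index_unique {lam : List Part} (h : lam.Pairwise Before) {p i j : ℕ}
    (hi : freePart p i ∈ lam) (hj : freePart p j ∈ lam) : i = j := by
  by_contra hij
  have := compatible_of_mem h hi hj (by simpa [freePart, freeColour] using hij)
  simp only [Compatible, before_iff, freePart, freeColour, true_and, and_true] at *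
  omega

theorem nodup_of_bound {lam : List Part} (h : lam.Pairwise Before)
    (hb : ∀ x ∈ lam, x.colour.1 ≠ x.colour.2) : lam.Nodup := by
  refine h.imp_of_mem ?_
  rintro x _ hx - hxy rfl
  exact hb x hx ((before_self_iff x).1 hxy)

theorem count_le_one_of_bound {lam : List Part} (h : lam.Pairwise Before) {x : Part}
    (hx : x.colour.1 ≠ x.colour.2) : lam.count x ≤ 1 := by
  have := nodup_of_bound (h.filter (fun y => decide (y.colour.1 ≠ y.colour.2)))
    (fun y hy => by simpa using (List.mem_filter.1 hy).2)
  rw [List.nodup_iff_count_le_one] at this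
  have hx := this x
  rwa [List.count_filter (by simpa)] at hx

theorem filter_eq_filter_of_bound {lam mu : List Part} (hl : lam.Pairwise Before)
    (hm : mu.Pairwise Before) (P : Part → Prop) [DecidablePred P]
    (hP : ∀ x, P x → x.colour.1 ≠ x.colour.2)
    (h : ∀ x : Part, x.colour.1 ≠ x.colour.2 → (x ∈ lam ↔ x ∈ mu)) :
    lam.filter P = mu.filter P := by
  have nd : ∀ l : List Part, l.Pairwise Before → (l.filter P).Nodup := fun l hl =>
    nodup_of_bound (hl.filter _) fun x hx => hP x (by simpa using (List.mem_filter.1 hx).2)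
  refine eq_of_perm_of_pairwise_before (hl.filter _) (hm.filter _)
    ((List.perm_ext_iff_of_nodup (nd _ hl) (nd _ hm)).2 fun x => ?_)
  simp only [List.mem_filter, decide_eq_true_eq]
  exact and_congr_left fun hx => h x (hP x hx)

/-! ### The two maps and their inverse relations -/

section bijection

variable {δ : BoundColour → ℤ} {γ : BoundColour → BoundColour → ℤ} {n : ℕ}

/-- The excluded colours depend on the bound parts only. -/
theorem excluded_congr {lam mu : List Part} (hl : lam.Pairwise Before)
    (hm : mu.Pairwise Before)
    (h : ∀ x : Part, x.colour.1 ≠ x.colour.2 → (x ∈ lam ↔ x ∈ mu)) (p : ℕ) :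
    excluded δ γ lam p = excluded δ γ mu p := by
  rw [excluded, excluded, filter_eq_filter_of_bound hl hm (LeftRelevant p) _ h,
    filter_eq_filter_of_bound hl hm (RightRelevant p) _ h] <;>
  · intro x hx
    simp only [LeftRelevant, RightRelevant] at hx
    omega

/-- The generalised Capparelli partition obtained by keeping the bound parts and one copy of each
free part whose colour is not the excluded one. -/
noncomputable def kept (δ : BoundColour → ℤ) (γ : BoundColour → BoundColour → ℤ) (lam : List Part) : List Part :=
  lam.dedup.filter fun x => x.colour.1 = x.colour.2 → x.colour.1 ≠ excluded δ γ lam x.size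

/-- The parts that are not kept. -/
noncomputable def removed (δ : BoundColour → ℤ) (γ : BoundColour → BoundColour → ℤ) (lam : List Part) :
    List Part :=
  lam.diff (kept δ γ lam)

/-- Replace the colour of a part by `a_0 b_0`. -/
def decolour (x : Part) : Part := freePart x.size 0

theorem mem_kept {lam : List Part} {x : Part} : x ∈ kept δ γ lam ↔
    x ∈ lam ∧ (x.colour.1 = x.colour.2 → x.colour.1 ≠ excluded δ γ lam x.size) := by
  rw [kept, List.mem_filter, List.mem_dedup, decide_eq_true_eq]

theorem kept_sublist (lam : List Part) : (kept δ γ lam).Sublist lam :=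
  List.filter_sublist.trans (List.dedup_sublist _)

theorem kept_append_removed_perm (lam : List Part) :
    (kept δ γ lam ++ removed δ γ lam).Perm lam :=
  List.subperm_append_diff_self_of_count_le fun x _ => (kept_sublist lam).count_le x

theorem removed_free {lam : List Part} (h : lam.Pairwise Before) {x : Part}
    (hx : x ∈ removed δ γ lam) : x.colour.1 = x.colour.2 := by
  by_contra hb
  have h₁ : x ∈ lam := (List.diff_sublist _ _).subset hx
  have h₂ : 0 < (kept δ γ lam).count x :=
    List.count_pos_iff.2 (mem_kept.2 ⟨h₁, fun h => absurd h hb⟩)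
  have h₃ : 0 < (removed δ γ lam).count x := List.count_pos_iff.2 hx
  rw [removed, List.count_diff] at h₃
  have := count_le_one_of_bound h hb
  omega

theorem primc_of_sublist {lam mu : List Part} (h : mu.Sublist lam) (hl : lam ∈ primc n) :
    mu ∈ primc n := by
  rw [mem_primc_iff] at *
  exact ⟨fun x hx => hl.1 x (h.subset hx), fun x hx => hl.2.1 x (h.subset hx), hl.2.2.sublist h⟩

theorem pairwise_before_of_mem_primc {lam : List Part} (h : lam ∈ primc n) :
    lam.Pairwise Before := (mem_primc_iff.1 h).2.2

theorem excluded_kept {lam : List Part} (h : lam.Pairwise Before) (p : ℕ) :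
    excluded δ γ (kept δ γ lam) p = excluded δ γ lam p :=
  excluded_congr (h.sublist (kept_sublist lam)) h
    (fun x hx => by simp [mem_kept, hx]) p

theorem kept_mem_capparelli (hδ : Condition1 δ) (hγ : Condition2 γ) {lam : List Part}
    (h : lam ∈ primc n) : kept δ γ lam ∈ capparelli n δ γ := by
  refine mem_capparelli_of_ne_excluded hδ hγ (primc_of_sublist (kept_sublist lam) h)
    ((List.nodup_dedup _).filter _) fun p i hi => ?_
  rw [excluded_kept (pairwise_before_of_mem_primc h)]
  exact (mem_kept.1 hi).2 rfl

theorem decolour_removed_mem_classical {lam : List Part} (h : lam ∈ primc n) :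
    (removed δ γ lam).map decolour ∈ classical := by
  obtain ⟨h₁, -, h₂⟩ := mem_primc_iff.1 h
  have hs : (removed δ γ lam).Sublist lam := List.diff_sublist _ _
  refine ⟨⟨?_, ?_⟩, ?_⟩
  · simp only [List.mem_map, forall_exists_index, and_imp, forall_apply_eq_imp_iff₂]
    exact fun x hx => h₁ x (hs.subset hx)
  · rw [List.pairwise_map]
    exact (h₂.sublist hs).imp Before.size_le
  · simp [decolour, freePart]

theorem pairwise_before_of_mem_classical {nu : List Part} (h : nu ∈ classical) :
    nu.Pairwise Before := by
  refine h.1.2.imp_of_mem fun {x y} hx hy hxy => ?_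
  rw [before_iff, h.2 x hx, h.2 y hy]
  simp only [freeColour, and_self, or_true, and_true]
  omega

/-- The free colour of the parts of size `p` in `mu`, or the excluded one if there is none. -/
noncomputable def colourAt (δ : BoundColour → ℤ) (γ : BoundColour → BoundColour → ℤ) (mu : List Part)
    (p : ℕ) : ℕ :=
  open Classical in
  if h : ∃ i, freePart p i ∈ mu then h.choose else excluded δ γ mu p

theorem colourAt_eq {mu : List Part} (h : mu.Pairwise Before) {p i : ℕ}
    (hi : freePart p i ∈ mu) : colourAt δ γ mu p = i := by
  have h' : ∃ i, freePart p i ∈ mu := ⟨i, hi⟩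
  rw [colourAt, dif_pos h']
  exact freePart_index_unique h h'.choose_spec hi

theorem freePart_colourAt (mu : List Part) (p : ℕ) :
    freePart p (colourAt δ γ mu p) ∈ mu ∨ colourAt δ γ mu p = excluded δ γ mu p := by
  by_cases h : ∃ i, freePart p i ∈ mu
  · left
    rw [colourAt, dif_pos h]
    exact h.choose_spec
  · right
    rw [colourAt, dif_neg h]

/-- The total preorder by which the parts of a generalised Primc partition are sorted. -/
def SortLE (x y : Part) : Prop :=
  y.size < x.size ∨
    (x.size = y.size ∧ x.colour.1 + y.colour.2 ≤ y.colour.1 + x.colour.2)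

noncomputable instance : DecidableRel SortLE := Classical.decRel _

instance : Std.Total SortLE := ⟨fun x y => by unfold SortLE; omega⟩

instance : IsTrans Part SortLE := ⟨fun x y z => by unfold SortLE; omega⟩

/-- `Before` forces sizes to decrease weakly and, at equal size, `k - ℓ` to increase weakly. Sorting
by these two keys therefore arranges any pairwise compatible multiset. -/
theorem SortLE.before {x y : Part} (h : SortLE x y) (hc : Compatible x y) : Before x y := by
  simp only [Compatible, before_iff, SortLE] at *
  omega

/-- Insert free parts of the sizes of `nu` into `mu`. -/
noncomputable def inserted (δ : BoundColour → ℤ) (γ : BoundColour → BoundColour → ℤ) (mu nu : List Part) :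
    List Part :=
  (mu ++ nu.map fun x => freePart x.size (colourAt δ γ mu x.size)).insertionSort SortLE

theorem inserted_perm (mu nu : List Part) : (inserted δ γ mu nu).Perm
    (mu ++ nu.map fun x => freePart x.size (colourAt δ γ mu x.size)) :=
  List.perm_insertionSort _ _

theorem mem_inserted {mu nu : List Part} {x : Part} : x ∈ inserted δ γ mu nu ↔
    x ∈ mu ∨ ∃ y ∈ nu, freePart y.size (colourAt δ γ mu y.size) = x := by
  simp [(inserted_perm mu nu).mem_iff]

theorem inserted_mem_primc (hn : 0 < n) (hδ : Condition1 δ) (hγ : Condition2 γ)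
    {mu nu : List Part} (hm : mu ∈ primc n) (hnu : ∀ x ∈ nu, 0 < x.size) :
    inserted δ γ mu nu ∈ primc n := by
  have hm' := hm
  rw [mem_primc_iff] at hm ⊢
  obtain ⟨h₁, h₂, h₃⟩ := hm
  refine ⟨fun x hx => ?_, fun x hx => ?_, ?_⟩
  · rcases mem_inserted.1 hx with hx | ⟨y, hy, rfl⟩
    · exact h₁ x hx
    · exact hnu y hy
  · rcases mem_inserted.1 hx with hx | ⟨y, hy, rfl⟩
    · exact h₂ x hx
    · rcases freePart_colourAt (δ := δ) (γ := γ) mu y.size with h | h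
      · exact h₂ _ h
      · rw [h]
        exact ⟨excluded_lt hn hδ hγ hm' _, excluded_lt hn hδ hγ hm' _⟩
  · have hc : (inserted δ γ mu nu).Pairwise Compatible := by
      rw [(inserted_perm mu nu).pairwise_iff Compatible.symm, List.pairwise_append]
      refine ⟨h₃.imp Or.inl, ?_, ?_⟩
      · rw [List.pairwise_map]
        exact List.pairwise_of_forall fun x y => compatible_freePart _ _ _ _ fun h => by rw [h]
      · intro x hx _ hy
        obtain ⟨y, -, rfl⟩ := List.mem_map.1 hy
        by_cases hb : x.colour.1 = x.colour.2
        · rw [eq_freePart hb] at hx ⊢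
          refine compatible_freePart _ _ _ _ fun h => ?_
          rw [← h]
          exact (colourAt_eq h₃ hx).symm
        · rcases freePart_colourAt (δ := δ) (γ := γ) mu y.size with h | h
          · exact compatible_of_mem h₃ hx h (by rintro rfl; exact hb rfl)
          · rw [h]
            exact compatible_excluded hδ hγ h₃ _ hx hb
    exact ((List.pairwise_insertionSort SortLE _).and hc).imp fun h => SortLE.before h.1 h.2

/-- Since the order of the parts is determined, only multisets need comparison: each removed part
must get its old colour back. -/
theorem inserted_kept (hn : 0 < n) (hδ : Condition1 δ) (hγ : Condition2 γ) {lam : List Part}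
    (h : lam ∈ primc n) :
    inserted δ γ (kept δ γ lam) ((removed δ γ lam).map decolour) = lam := by
  have hB := pairwise_before_of_mem_primc h
  refine eq_of_perm_of_pairwise_before (pairwise_before_of_mem_primc
    (inserted_mem_primc hn hδ hγ (primc_of_sublist (kept_sublist lam) h)
      (decolour_removed_mem_classical h).1.1)) hB
    ((inserted_perm _ _).trans ?_)
  rw [List.map_map]
  have e : (removed δ γ lam).map ((fun x => freePart x.size
      (colourAt δ γ (kept δ γ lam) x.size)) ∘ decolour) = removed δ γ lam := by
    refine (List.map_congr_left fun x hx => ?_).trans (List.map_id _)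
    have hf := removed_free hB hx
    have hx' : x ∈ lam := (List.diff_sublist _ _).subset hx
    refine Eq.trans ?_ (eq_freePart hf).symm
    change freePart x.size _ = _
    congr 1
    change colourAt δ γ (kept δ γ lam) x.size = _
    rw [eq_freePart hf] at hx'
    rcases freePart_colourAt (δ := δ) (γ := γ) (kept δ γ lam) x.size with h' | h'
    · exact freePart_index_unique hB ((kept_sublist lam).subset h') hx'
    -- If the colour of `x` were not the excluded one, a copy of `x` would be kept and would
    -- determine `colourAt`.
    · by_contra hne
      refine hne (colourAt_eq (hB.sublist (kept_sublist lam)) (mem_kept.2 ⟨hx', fun _ => ?_⟩))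
      rw [h', excluded_kept hB] at hne
      exact Ne.symm hne
  rw [e]
  exact kept_append_removed_perm lam

theorem mem_inserted_iff_of_bound {mu nu : List Part} {x : Part} (hx : x.colour.1 ≠ x.colour.2) :
    x ∈ inserted δ γ mu nu ↔ x ∈ mu := by
  rw [mem_inserted]
  refine or_iff_left ?_
  rintro ⟨y, -, rfl⟩
  exact hx rfl

theorem kept_inserted (hn : 0 < n) (hδ : Condition1 δ) (hγ : Condition2 γ) {mu nu : List Part}
    (hm : mu ∈ capparelli n δ γ) (hnu : nu ∈ classical) :
    kept δ γ (inserted δ γ mu nu) = mu := by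
  have hB := pairwise_before_of_mem_primc hm.1
  have hI := pairwise_before_of_mem_primc (inserted_mem_primc hn hδ hγ hm.1 hnu.1.1)
  have hd := nodup_of_mem_capparelli hm
  refine eq_of_perm_of_pairwise_before (hI.sublist (kept_sublist _)) hB
    ((List.perm_ext_iff_of_nodup ((List.nodup_dedup _).filter _) hd).2 fun x => ?_)
  refine mem_kept.trans ?_
  by_cases hx : x.colour.1 = x.colour.2
  · rw [excluded_congr hI hB fun x hx => mem_inserted_iff_of_bound hx]
    constructor
    · rintro ⟨h₁, h₂⟩
      rcases mem_inserted.1 h₁ with h₁ | ⟨y, hy, rfl⟩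
      · exact h₁
      · exact (freePart_colourAt mu y.size).resolve_right (h₂ hx)
    · intro h
      refine ⟨mem_inserted.2 (Or.inl h), fun _ => ?_⟩
      rw [eq_freePart hx] at h
      obtain ⟨pre, post, rfl⟩ := List.append_of_mem h
      exact ne_excluded_of_mem_capparelli hδ hγ hm hd
  · simp [mem_inserted_iff_of_bound hx, hx]

/-- As the kept parts are exactly `mu`, they cancel from the multiset, leaving the inserted free
parts, whose recolouring is `nu`. -/
theorem removed_inserted (hn : 0 < n) (hδ : Condition1 δ) (hγ : Condition2 γ) {mu nu : List Part}
    (hm : mu ∈ capparelli n δ γ) (hnu : nu ∈ classical) :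
    (removed δ γ (inserted δ γ mu nu)).map decolour = nu := by
  have hI := inserted_mem_primc hn hδ hγ hm.1 hnu.1.1
  refine eq_of_perm_of_pairwise_before (pairwise_before_of_mem_classical
    (decolour_removed_mem_classical hI)) (pairwise_before_of_mem_classical hnu) ?_
  have h := kept_append_removed_perm (δ := δ) (γ := γ) (inserted δ γ mu nu)
  rw [kept_inserted hn hδ hγ hm hnu] at h
  refine (((List.perm_append_left_iff mu).1 (h.trans (inserted_perm mu nu))).map decolour).trans ?_
  rw [List.map_map]
  refine List.Perm.of_eq ((List.map_congr_left fun x hx => ?_).trans (List.map_id _))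
  have e := hnu.2 x hx
  exact Part.ext' rfl (congrArg Prod.fst e).symm (congrArg Prod.snd e).symm

/-- The bijection between generalised Primc partitions and pairs of a generalised Capparelli
partition and a classical partition. -/
noncomputable def primcEquiv (hn : 0 < n) (hδ : Condition1 δ) (hγ : Condition2 γ) :
    primc n ≃ capparelli n δ γ × classical where
  toFun lam := (⟨kept δ γ lam.1, kept_mem_capparelli hδ hγ lam.2⟩,
    ⟨(removed δ γ lam.1).map decolour, decolour_removed_mem_classical lam.2⟩)
  invFun π := ⟨inserted δ γ π.1.1 π.2.1,
    inserted_mem_primc hn hδ hγ π.1.2.1 π.2.2.1.1⟩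
  left_inv lam := Subtype.ext (inserted_kept hn hδ hγ lam.2)
  right_inv π := Prod.ext (Subtype.ext (kept_inserted hn hδ hγ π.1.2 π.2.2))
    (Subtype.ext (removed_inserted hn hδ hγ π.1.2 π.2.2))

/-! ### The preserved statistics -/

theorem sizes_eq_kept_add_removed (lam : List Part) :
    sizes lam = sizes (kept δ γ lam) + sizes ((removed δ γ lam).map decolour) := by
  have h := ((kept_append_removed_perm (δ := δ) (γ := γ) lam).map Part.size).symm
  rw [List.map_append] at h
  have e : ((removed δ γ lam).map decolour).map Part.size = (removed δ γ lam).map Part.size := by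
    rw [List.map_map]; rfl
  rw [sizes, sizes, sizes, e, Multiset.coe_add]
  exact Multiset.coe_eq_coe.2 h

theorem weight_eq_sum_sizes (lam : List Part) : weight lam = (sizes lam).sum :=
  (Multiset.sum_coe _).symm

theorem length_eq_card_sizes (lam : List Part) : lam.length = (sizes lam).card := by
  simp [sizes]

theorem colourCount_eq_kept_add_removed {lam : List Part} (h : lam.Pairwise Before)
    (c : BoundColour) : colourCount c.1 lam =
      colourCount c.1 (kept δ γ lam) + colourCount c.1 ((removed δ γ lam).map decolour) := by
  have e₁ : colourCount c.1 (removed δ γ lam) = 0 := by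
    rw [colourCount, List.countP_eq_zero]
    intro x hx hc
    apply c.2
    rw [← of_decide_eq_true hc]
    exact removed_free h hx
  have e₂ : colourCount c.1 ((removed δ γ lam).map decolour) = 0 := by
    rw [colourCount, List.countP_eq_zero]
    intro x hx hc
    obtain ⟨y, -, rfl⟩ := List.mem_map.1 hx
    apply c.2
    rw [← of_decide_eq_true hc]
    rfl
  have h := (kept_append_removed_perm (δ := δ) (γ := γ) lam).countP_eq
    (fun x => decide (x.colour = c.1))
  rw [List.countP_append] at h
  rw [e₂]
  rw [colourCount] at e₁ ⊢
  rw [← h, e₁]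
  rfl

end bijection

end GenPrimc

theorem mainTheorem4 (n : ℕ) (hn : 0 < n)
    (δ : GenPrimc.BoundColour → ℤ) (hδ : GenPrimc.Condition1 δ)
    (γ : GenPrimc.BoundColour → GenPrimc.BoundColour → ℤ) (hγ : GenPrimc.Condition2 γ) :
    ∃ Φ : GenPrimc.primc n ≃ GenPrimc.capparelli n δ γ × GenPrimc.classical,
      ∀ lam : GenPrimc.primc n,
        GenPrimc.weight lam.1 =
          GenPrimc.weight (Φ lam).1.1 + GenPrimc.weight (Φ lam).2.1 ∧
        lam.1.length = (Φ lam).1.1.length + (Φ lam).2.1.length ∧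
        GenPrimc.sizes lam.1 =
          GenPrimc.sizes (Φ lam).1.1 + GenPrimc.sizes (Φ lam).2.1 ∧
        ∀ c : GenPrimc.BoundColour,
          GenPrimc.colourCount c.1 lam.1 =
            GenPrimc.colourCount c.1 (Φ lam).1.1 + GenPrimc.colourCount c.1 (Φ lam).2.1 := by
  refine ⟨GenPrimc.primcEquiv hn hδ hγ, fun lam => ?_⟩
  have hs := GenPrimc.sizes_eq_kept_add_removed (δ := δ) (γ := γ) lam.1
  refine ⟨?_, ?_, hs, GenPrimc.colourCount_eq_kept_add_removed
    (GenPrimc.pairwise_before_of_mem_primc lam.2)⟩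
  · simp only [GenPrimc.weight_eq_sum_sizes]
    rw [hs, Multiset.sum_add]
    rfl
  · simp only [GenPrimc.length_eq_card_sizes]
    rw [hs, Multiset.card_add]
    rfl
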